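/- Let $T_0>0$. For a measurable function $w$ on $(0,\infty)\times(0,T_0)$ consider the linear quarter-plane (Airy) problem with zero data $$\begin{cases}\partial_t w+\partial_x^3 w=0, & x>0,\ t\in(0,T_0),\\ w(x,0)=0, & x>0,\\ w(0,t)=0, & t\in[0,T_0].\end{cases}$$ Here $w$ belongs to $C([0,T_0];L^2(0,\infty))\cap C([0,\infty);H^{1/3}(0,T_0))$, where the first space is understood through the slices $t\mapsto w(\cdot,t)$ and the second through the slices $x\mapsto w(x,\cdot)$. For an interval $I$ and $s\ge 0$, $H^s(I)$ is the space of restrictions to $I$ of functions in $H^s(\mathbb R)=\{F\in L^2(\mathbb R):(1+|\xi|)^s\hat F(\xi)\in L^2(\mathbb R)\}$, with norm $\|f\|_{H^s(I)}=\inf\{\|F\|_{H^s(\mathbb R)}: F|_I=f\}$. The equation holds in the sense of distributions on $(0,\infty)\times(0,T_0)$. The initial condition says that the continuous curve $t\mapsto w(\cdot,t)\in L^2(0,\infty)$ vanishes at $t=0$, and the lateral condition says that the continuous curve $x\mapsto w(x,\cdot)\in H^{1/3}(0,T_0)$ vanishes at $x=0$. If $w$ is a (real- or complex-valued) solution of this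 problem, then $w\equiv 0$ on $(0,\infty)\times[0,T_0]$: $w(\cdot,t)=0$ in $L^2(0,\infty)$ for every $t\in[0,T_0]$, and $w(x,\cdot)=0$ in $H^{1/3}(0,T_0)$ for every $x\ge 0$. -/

import Mathlib

open MeasureTheory Set Filter Topology
open scoped ENNReal FourierTransform Distributions

noncomputable section

namespace AiryQuarterPlane

/-- The norm of `F ∈ L²(ℝ)` in `H^s(ℝ)`, `s ≥ 0`, that is the `L²` norm of `(1 + |ξ|)^s F̂(ξ)`,
with the value `∞` when `F` is not in `H^s(ℝ)`. Here `F̂` is the Plancherel Fourier transform. -/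
def sobolevNorm (s : ℝ) (F : Lp ℂ 2 (volume : Measure ℝ)) : ℝ≥0∞ :=
  eLpNorm (fun ξ : ℝ => (((1 + |ξ|) ^ s : ℝ) : ℂ) * (𝓕 F : Lp ℂ 2 (volume : Measure ℝ)) ξ) 2 volume

/-- The norm in `H^s(I)`, `s ≥ 0`, as a quotient norm: the infimum of the `H^s(ℝ)` norms of all
extensions of `f|_I` to `ℝ`. It is `∞` when there is no extension in `H^s(ℝ)`. -/
def sobolevNormOn (s : ℝ) (I : Set ℝ) (f : ℝ → ℂ) : ℝ≥0∞ :=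
  ⨅ (F : Lp ℂ 2 (volume : Measure ℝ)) (_ : F =ᵐ[volume.restrict I] f), sobolevNorm s F

/-- `f|_I ∈ H^s(I)`. -/
def MemSobolevOn (s : ℝ) (I : Set ℝ) (f : ℝ → ℂ) : Prop :=
  sobolevNormOn s I f < ∞

/-- `v ∈ C(J; L²(I))`, the value of `v` at `t ∈ J` being the class of `v t` on `I`. -/
def ContinuousInL2 (J I : Set ℝ) (v : ℝ → ℝ → ℂ) : Prop :=
  (∀ t ∈ J, MemLp (v t) 2 (volume.restrict I)) ∧
  ∀ t₀ ∈ J, Tendsto (fun t => eLpNorm (v t - v t₀) 2 (volume.restrict I)) (𝓝[J] t₀) (𝓝 0)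

/-- `v ∈ C(J; H^s(I))`, the value of `v` at `x ∈ J` being the class of `v x` on `I`. -/
def ContinuousInSobolev (s : ℝ) (J I : Set ℝ) (v : ℝ → ℝ → ℂ) : Prop :=
  (∀ x ∈ J, MemSobolevOn s I (v x)) ∧
  ∀ x₀ ∈ J, Tendsto (fun x => sobolevNormOn s I (v x - v x₀)) (𝓝[J] x₀) (𝓝 0)

/-- The open set `{(x, t) : x > 0, 0 < t < T₀}`. -/
def domain (T₀ : ℝ) : TopologicalSpace.Opens (ℝ × ℝ) :=
  ⟨Ioi 0 ×ˢ Ioo 0 T₀, isOpen_Ioi.prod isOpen_Ioo⟩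

/-- `∂_t w + ∂_x³ w = 0` in `𝓓'((0, ∞) × (0, T₀))`: both derivatives have odd order, so that moving
them onto the test function gives `∫∫ w (∂_t ψ + ∂_x³ ψ) dx dt = 0`. -/
def SolvesAiry (T₀ : ℝ) (w : ℝ → ℝ → ℂ) : Prop :=
  ∀ ψ : 𝓓(domain T₀, ℝ),
    ∫ p in (domain T₀ : Set (ℝ × ℝ)),
      w p.1 p.2 * ((deriv (fun t => ψ (p.1, t)) p.2
        + iteratedDeriv 3 (fun x => ψ (x, p.2)) p.1 : ℝ) : ℂ) = 0

/-- `w` (with `w x t` the value at position `x` and time `t`) is a solution, at regularity `s = 0`,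
of `∂_t w + ∂_x³ w = 0` for `x > 0`, `0 < t < T₀`, with `w(x, 0) = φ(x)` and `w(0, t) = f(t)`.
All time slices with `t ∈ [0, T₀]` and all space slices with `x ∈ [0, ∞)` of the one function `w`
are those of the corresponding continuous curves in `L²(0, ∞)` and `H^{1/3}(0, T₀)`. -/
structure IsSolution (T₀ : ℝ) (φ f : ℝ → ℂ) (w : ℝ → ℝ → ℂ) : Prop where
  /-- `w` is (the class of) a measurable function on the space-time domain. -/
  aestronglyMeasurable : AEStronglyMeasurable (fun p : ℝ × ℝ => w p.1 p.2)
    (volume.restrict (domain T₀ : Set (ℝ × ℝ)))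
  /-- `w ∈ C([0, T₀]; L²(0, ∞))`. -/
  continuous_time : ContinuousInL2 (Icc 0 T₀) (Ioi 0) (fun t x => w x t)
  /-- `w ∈ C([0, ∞); H^{1/3}(0, T₀))`. -/
  continuous_space : ContinuousInSobolev (1 / 3) (Ici 0) (Ioo 0 T₀) w
  /-- The equation, in the sense of distributions. -/
  equation : SolvesAiry T₀ w
  /-- The value at `t = 0` of the curve in `L²(0, ∞)` is `φ`. -/
  initial : (fun x => w x 0) =ᵐ[volume.restrict (Ioi 0)] φ
  /-- The value at `x = 0` of the curve in `H^{1/3}(0, T₀)` is `f`. -/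
  lateral : w 0 =ᵐ[volume.restrict (Ioo 0 T₀)] f

end AiryQuarterPlane

end

noncomputable section

namespace AiryQuarterPlane

open scoped ContDiff

/-! The proof is an energy argument applied to time primitives of `w` instead of `w` itself, which
is too rough to be multiplied by its own derivatives. Let W₁ and W₂ be the first and second
primitives of `w` in time, both starting from 0 at t = 0. Since x ↦ w(x, ·) is continuous into L²(0,
T), both are jointly continuous and vanish at x = 0. Testing the equation with tensor products and
using the zero initial value gives ∂ₜW₂ = W₁ and, weakly in x at each time, ∂ₓ³W₂ = -W₁
(`integral_iteratedDeriv_smul_timePrimitive₂`). The second primitive is there so that W₁, which is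
continuous, stands on the right: then W₂(·, t) is C³ on the open half line by du Bois-Reymond
(`exists_weak_primitive`), with one-sided derivatives up to x = 0. At a fixed time W₂ and W₁ lie in
L²(0, ∞), which forces W₂ and its first two derivatives to tend to 0 at infinity (`tendsto_jet`).
Integration by parts then leaves only the boundary term: 2 Re ∫ conj(W₂) W₁ dx = -|∂ₓW₂(0, t)|² ≤ 0.
The left side is the time derivative of ‖W₂(t)‖² in integrated form, and W₂ = 0 at t = 0, so W₂ = 0.
Differentiating twice in time, the second time almost everywhere, gives w(x, ·) = 0 for each x > 0.
Fubini and continuity in time give the time slices. -/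

/-- `φ` is a smooth real function with compact support contained in `I`. -/
structure IsTest (I : Set ℝ) (φ : ℝ → ℝ) : Prop where
  contDiff : ContDiff ℝ ∞ φ
  hasCompactSupport : HasCompactSupport φ
  tsupport_subset : tsupport φ ⊆ I

/-! ### Test functions on an interval -/

namespace IsTest

variable {I : Set ℝ} {φ θ : ℝ → ℝ}

lemma eq_zero_of_notMem (hφ : IsTest I φ) {x : ℝ} (hx : x ∉ I) : φ x = 0 :=
  image_eq_zero_of_notMem_tsupport fun h => hx (hφ.tsupport_subset h)

lemma sub (hφ : IsTest I φ) (hθ : IsTest I θ) : IsTest I (φ - θ) where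
  contDiff := hφ.contDiff.sub hθ.contDiff
  hasCompactSupport := hφ.hasCompactSupport.sub hθ.hasCompactSupport
  tsupport_subset := (tsupport_sub φ θ).trans
    (union_subset hφ.tsupport_subset hθ.tsupport_subset)

lemma const_smul (hφ : IsTest I φ) (c : ℝ) : IsTest I (c • φ) where
  contDiff := contDiff_const.smul hφ.contDiff
  hasCompactSupport := hφ.hasCompactSupport.smul_left
  tsupport_subset := (tsupport_smul_subset_right (fun _ => c) φ).trans hφ.tsupport_subset

lemma deriv (hφ : IsTest I φ) : IsTest I (deriv φ) where
  contDiff := hφ.contDiff.deriv'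
  hasCompactSupport := hφ.hasCompactSupport.deriv
  tsupport_subset := (closure_minimal support_deriv_subset (isClosed_tsupport φ)).trans
    hφ.tsupport_subset

lemma iteratedDeriv (hφ : IsTest I φ) (k : ℕ) : IsTest I (iteratedDeriv k φ) := by
  induction k with
  | zero => simpa using hφ
  | succ k ih => rw [iteratedDeriv_succ]; exact ih.deriv

lemma integrable_smul (hφ : IsTest I φ) {u : ℝ → ℂ} (hu : Continuous u) :
    Integrable (fun x => φ x • u x) :=
  (hφ.contDiff.continuous.smul hu).integrable_of_hasCompactSupport hφ.hasCompactSupport.smul_right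

lemma integrable (hφ : IsTest I φ) : Integrable φ :=
  hφ.contDiff.continuous.integrable_of_hasCompactSupport hφ.hasCompactSupport

lemma integral_deriv_smul (hφ : IsTest I φ) {F f : ℝ → ℂ} (hf : Continuous f)
    (hF : ∀ x, HasDerivAt F (f x) x) :
    ∫ x, _root_.deriv φ x • F x = -∫ x, φ x • f x := by
  have hFc : Continuous F := continuous_iff_continuousAt.2 fun x => (hF x).continuousAt
  have h := integral_bilinear_hasDerivAt_right_eq_neg_left_of_integrable
    (L := ContinuousLinearMap.lsmul ℝ ℝ) (u := φ) (u' := _root_.deriv φ) (v := F) (v' := f)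
    (fun x _ => ((hφ.contDiff.differentiable (by simp)) x).hasDerivAt) (fun x _ => hF x)
    (hφ.integrable_smul hf) (hφ.deriv.integrable_smul hFc) (hφ.integrable_smul hFc)
  simp only [ContinuousLinearMap.lsmul_apply] at h
  rw [h, neg_neg]

/-- A test function of mean zero is the derivative of a test function. -/
lemma exists_deriv_eq (hI : I.OrdConnected) (hθ : IsTest I θ) (h0 : ∫ x, θ x = 0) :
    ∃ η, IsTest I η ∧ _root_.deriv η = θ := by
  rcases (tsupport θ).eq_empty_or_nonempty with he | hne
  · have : θ = 0 := tsupport_eq_empty_iff.1 he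
    exact ⟨θ, hθ, by simp [this]⟩
  have hK : IsCompact (tsupport θ) := hθ.hasCompactSupport
  obtain ⟨m, hm, hmin⟩ := hK.exists_isLeast hne
  obtain ⟨M, hM, hmax⟩ := hK.exists_isGreatest hne
  have hzero : ∀ x, x ∉ Icc m M → θ x = 0 := fun x hx =>
    image_eq_zero_of_notMem_tsupport fun h => hx ⟨hmin h, hmax h⟩
  have hc := hθ.contDiff.continuous
  set η : ℝ → ℝ := fun x => ∫ y in m..x, θ y with hη
  have hd : ∀ x, HasDerivAt η (θ x) x := fun x =>
    intervalIntegral.integral_hasDerivAt_right (hc.intervalIntegrable _ _)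
      (hc.stronglyMeasurableAtFilter _ _) hc.continuousAt
  have hderiv : _root_.deriv η = θ := funext fun x => (hd x).deriv
  have hsupp : Function.support η ⊆ Icc m M := by
    intro x hx
    by_contra hx'
    apply hx
    rcases not_and_or.1 hx' with h | h
    -- Left of the support. The point m itself lies in the support, so it is discarded as a null
    -- set.
    · have : ∀ y ∈ uIcc m x, y ≠ m → θ y = 0 := by
        intro y hy hym
        rw [uIcc_of_ge (not_le.1 h).le] at hy
        exact hzero y fun h' => hym (le_antisymm hy.2 h'.1)
      simp only [hη]
      apply intervalIntegral.integral_zero_ae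
      filter_upwards [compl_mem_ae_iff.2 (measure_singleton (μ := volume) m)] with y hy hyI
      exact this y (uIoc_subset_uIcc hyI) hy
    -- Right of the support the primitive has collected the whole integral, which is 0.
    · have hMx : M < x := not_le.1 h
      simp only [hη]
      rw [intervalIntegral.integral_of_le ((hmin hM).trans hMx.le), ← h0,
        ← integral_Icc_eq_integral_Ioc]
      refine setIntegral_eq_integral_of_forall_compl_eq_zero fun y hy => hzero y fun h' => hy ?_
      exact ⟨h'.1, h'.2.trans hMx.le⟩
  have hts : tsupport η ⊆ Icc m M := closure_minimal hsupp isClosed_Icc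
  refine ⟨η, ⟨?_, ?_, ?_⟩, hderiv⟩
  · rw [contDiff_infty_iff_deriv, hderiv]
    exact ⟨fun x => (hd x).differentiableAt, hθ.contDiff⟩
  · exact HasCompactSupport.of_support_subset_isCompact isCompact_Icc hsupp
  · exact hts.trans (hI.out (hθ.tsupport_subset hm) (hθ.tsupport_subset hM))

/-- There is a test function of mean one in every nonempty open set. -/
lemma exists_integral_eq_one (hI : IsOpen I) (hne : I.Nonempty) :
    ∃ θ, IsTest I θ ∧ ∫ x, θ x = 1 := by
  obtain ⟨c, hc⟩ := hne
  obtain ⟨ε, hε, hball⟩ := Metric.isOpen_iff.1 hI c hc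
  let b : ContDiffBump c := ⟨ε / 4, ε / 2, by positivity, by linarith⟩
  refine ⟨b.normed volume, ⟨b.contDiff_normed, b.hasCompactSupport_normed, ?_⟩,
    b.integral_normed⟩
  rw [b.tsupport_normed_eq]
  exact (Metric.closedBall_subset_ball (by change ε / 2 < ε; linarith)).trans hball

end IsTest

/-! ### Weak derivatives on an interval (du Bois-Reymond) -/

variable {I : Set ℝ}

/-- If the derivative of order `k + 1` of `u` is `± f` weakly on the interval `I`, then
the derivative of order `k` is `± F` for some primitive `F` of `f`. -/
lemma exists_weak_primitive (hI : IsOpen I) (hne : I.Nonempty) (hconn : I.OrdConnected)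
    {u f : ℝ → ℂ} (hu : Continuous u) (hf : Continuous f) (k : ℕ)
    (h : ∀ φ, IsTest I φ → ∫ x, iteratedDeriv (k + 1) φ x • u x = ∫ x, φ x • f x) :
    ∃ F : ℝ → ℂ, (∀ x, HasDerivAt F (f x) x) ∧
      ∀ φ, IsTest I φ → ∫ x, iteratedDeriv k φ x • u x = -∫ x, φ x • F x := by
  obtain ⟨θ₀, hθ₀, hone⟩ := IsTest.exists_integral_eq_one hI hne
  set G : ℝ → ℂ := fun x => ∫ y in (0 : ℝ)..x, f y with hG
  have hGd : ∀ x, HasDerivAt G (f x) x := fun x =>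
    intervalIntegral.integral_hasDerivAt_right (hf.intervalIntegrable _ _)
      (hf.stronglyMeasurableAtFilter _ _) hf.continuousAt
  have hGc : Continuous G := continuous_iff_continuousAt.2 fun x => (hGd x).continuousAt
  -- The constant that makes the conclusion hold for `θ₀`. Any other θ differs from a multiple of
  -- `θ₀` by the derivative of a test function, to which `h` applies.
  set c : ℂ := (∫ x, iteratedDeriv k θ₀ x • u x) + ∫ x, θ₀ x • G x with hc
  refine ⟨fun x => G x - c, fun x => (hGd x).sub_const c, fun θ hθ => ?_⟩
  set m : ℝ := ∫ x, θ x with hm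
  have hmean : ∫ x, (θ - m • θ₀) x = 0 := by
    simp only [Pi.sub_apply]
    rw [integral_sub hθ.integrable (hθ₀.const_smul m).integrable]
    simp only [Pi.smul_apply]
    rw [integral_smul, hone]
    simp [hm]
  obtain ⟨η, hη, hηd⟩ := (hθ.sub (hθ₀.const_smul m)).exists_deriv_eq hconn hmean
  have h1 := h η hη
  have h2 := hη.integral_deriv_smul hf hGd
  rw [hηd] at h2
  rw [iteratedDeriv_succ', hηd] at h1
  have h3 : ∀ x, iteratedDeriv k (θ - m • θ₀) x
      = iteratedDeriv k θ x - m * iteratedDeriv k θ₀ x := by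
    intro x
    rw [iteratedDeriv_sub (hθ.contDiff.contDiffAt.of_le (by exact_mod_cast le_top))
      ((hθ₀.const_smul m).contDiff.contDiffAt.of_le (by exact_mod_cast le_top)),
      iteratedDeriv_const_smul_field]
    simp
  have e1 : ∫ x, iteratedDeriv k (θ - m • θ₀) x • u x
      = (∫ x, iteratedDeriv k θ x • u x) - m • ∫ x, iteratedDeriv k θ₀ x • u x := by
    simp_rw [h3, sub_smul, mul_smul]
    rw [← integral_smul]
    exact integral_sub ((hθ.iteratedDeriv k).integrable_smul hu)
      (((hθ₀.iteratedDeriv k).integrable_smul hu).smul m)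
  have e2 : ∫ x, (θ - m • θ₀) x • G x = (∫ x, θ x • G x) - m • ∫ x, θ₀ x • G x := by
    simp only [Pi.sub_apply, Pi.smul_apply, sub_smul, smul_eq_mul, mul_smul]
    rw [← integral_smul]
    exact integral_sub (hθ.integrable_smul hGc) ((hθ₀.integrable_smul hGc).smul m)
  have e3 : ∫ x, θ x • (G x - c) = (∫ x, θ x • G x) - m • c := by
    simp_rw [smul_sub]
    rw [integral_sub (hθ.integrable_smul hGc) (hθ.integrable.smul_const c), integral_smul_const]
  rw [e3, hc]
  rw [e1] at h1
  rw [e2] at h2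
  simp only [smul_add]
  linear_combination h1 + h2

lemma eqOn_of_integral_smul_eq (hI : IsOpen I) {u v : ℝ → ℂ} (hu : Continuous u)
    (hv : Continuous v) (h : ∀ φ, IsTest I φ → ∫ x, φ x • u x = ∫ x, φ x • v x) : EqOn u v I := by
  have h0 : ∀ᵐ x ∂(volume : Measure ℝ), x ∈ I → u x - v x = 0 := by
    refine hI.ae_eq_zero_of_integral_contDiff_smul_eq_zero
      (f := fun x => u x - v x) ((hu.sub hv).locallyIntegrable.locallyIntegrableOn _) ?_
    intro φ h1 h2 h3
    have hφ : IsTest I φ := ⟨h1, h2, h3⟩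
    simp_rw [smul_sub]
    rw [integral_sub (hφ.integrable_smul hu) (hφ.integrable_smul hv), h φ hφ, sub_self]
  refine Measure.eqOn_open_of_ae_eq (μ := volume) ?_ hI hu.continuousOn hv.continuousOn
  refine (ae_restrict_iff' hI.measurableSet).2 (h0.mono fun x hx hxI => sub_eq_zero.1 (hx hxI))

/-! ### Decay at infinity and the sign of the boundary flux -/

lemma sq_integral_le {α : Type*} [MeasurableSpace α] {μ : Measure α} [IsFiniteMeasure μ]
    {g : α → ℝ} (hg : MemLp g 2 μ) : (∫ x, g x ∂μ) ^ 2 ≤ μ.real univ * ∫ x, g x ^ 2 ∂μ := by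
  have hg1 : Integrable g μ := hg.integrable (by norm_num)
  have hg2 : Integrable (fun x => g x ^ 2) μ := hg.integrable_sq
  set A := ∫ x, g x ∂μ with hA
  set m := μ.real univ with hm
  rcases (measureReal_nonneg (μ := μ) (s := univ)).eq_or_lt with h0 | h0
  · have hμ : μ = 0 := by
      rw [← Measure.measure_univ_eq_zero]
      exact (measureReal_eq_zero_iff (measure_ne_top μ univ)).1 h0.symm
    simp [hA, hμ]
  -- The variance of g, scaled by m to avoid division.
  · have h1 : 0 ≤ ∫ x, (m * g x - A) ^ 2 ∂μ := integral_nonneg fun x => sq_nonneg _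
    have h2 : ∫ x, (m * g x - A) ^ 2 ∂μ = m ^ 2 * (∫ x, g x ^ 2 ∂μ) - 2 * m * A * A + A ^ 2 * m := by
      have : ∀ x, (m * g x - A) ^ 2 = m ^ 2 * g x ^ 2 - 2 * m * A * g x + A ^ 2 := fun x => by ring
      simp_rw [this]
      rw [integral_add (by exact (hg2.const_mul _).sub (hg1.const_mul _)) (integrable_const _),
        integral_sub (hg2.const_mul _) (hg1.const_mul _), integral_const_mul, integral_const_mul,
        integral_const, smul_eq_mul, ← hA, ← hm]
      ring
    rw [h2] at h1
    have h3 : 0 ≤ m * (m * (∫ x, g x ^ 2 ∂μ) - A ^ 2) := by linarith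
    have := nonneg_of_mul_nonneg_right h3 h0
    linarith

/-- By Cauchy-Schwarz on a window of length one, the square is at most an increment of the
convergent integral of ‖F‖². -/
lemma tendsto_integral_norm_window {F : ℝ → ℂ} (hF : Continuous F)
    (h2 : MemLp F 2 (volume.restrict (Ioi 0))) :
    Tendsto (fun x => ∫ y in x..x + 1, ‖F y‖) atTop (𝓝 0) := by
  have hint : IntegrableOn (fun y => ‖F y‖ ^ 2) (Ioi 0) := h2.norm.integrable_sq
  have hc : Continuous fun y => ‖F y‖ ^ 2 := by fun_prop
  have hlim := intervalIntegral_tendsto_integral_Ioi 0 hint tendsto_id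
  have hlim' := hlim.comp (tendsto_atTop_add_const_right atTop (1 : ℝ) tendsto_id)
  have hdiff := hlim'.sub hlim
  rw [sub_self] at hdiff
  have hsq : Tendsto (fun x => (∫ y in x..x + 1, ‖F y‖) ^ 2) atTop (𝓝 0) := by
    refine squeeze_zero (fun x => sq_nonneg _) (fun x => ?_) hdiff
    simp only [Function.comp, id]
    rw [intervalIntegral.integral_interval_sub_left (hc.intervalIntegrable _ _)
      (hc.intervalIntegrable _ _), intervalIntegral.integral_of_le (by linarith),
      intervalIntegral.integral_of_le (by linarith)]
    have hm : MemLp (fun y => ‖F y‖) 2 (volume.restrict (Ioc x (x + 1))) := by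
      refine (memLp_two_iff_integrable_sq hF.norm.aestronglyMeasurable).2 ?_
      exact (hc.integrableOn_Icc (a := x) (b := x + 1)).mono_set Ioc_subset_Icc_self
    have := sq_integral_le hm
    simpa [Measure.real] using this
  have := hsq.sqrt
  simp only [Real.sqrt_zero] at this
  refine this.congr fun x => Real.sqrt_sq ?_
  exact intervalIntegral.integral_nonneg (by linarith) fun y _ => norm_nonneg _

section Decay

variable {F₀ F₁ F₂ F₃ : ℝ → ℂ} (h₀ : ∀ x, HasDerivAt F₀ (F₁ x) x)
  (h₁ : ∀ x, HasDerivAt F₁ (F₂ x) x) (h₂ : ∀ x, HasDerivAt F₂ (F₃ x) x) (hc : Continuous F₃)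
  (hF₀ : MemLp F₀ 2 (volume.restrict (Ioi 0))) (hF₃ : MemLp F₃ 2 (volume.restrict (Ioi 0)))

include h₀ h₁ h₂ hc hF₀ hF₃

open Polynomial in
/-- Integrating by parts against a polynomial that vanishes to third order at the right end of
a window of length one. -/
lemma tendsto_jet_combination (P : ℂ[X]) (hP : P.eval 1 = 0)
    (hP' : (derivative P).eval 1 = 0) (hP'' : (derivative (derivative P)).eval 1 = 0) :
    Tendsto (fun x => F₂ x * P.eval 0 - F₁ x * (derivative P).eval 0
      + F₀ x * (derivative (derivative P)).eval 0) atTop (𝓝 0) := by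
  have hcont₀ : Continuous F₀ := continuous_iff_continuousAt.2 fun x => (h₀ x).continuousAt
  have hQ : ∀ (Q : ℂ[X]) (x y : ℝ),
      HasDerivAt (fun y : ℝ => Q.eval ((y - x : ℝ) : ℂ)) ((derivative Q).eval ((y - x : ℝ) : ℂ)) y := by
    intro Q x y
    have h := (Q.hasDerivAt ((y - x : ℝ) : ℂ)).comp_ofReal (z := y - x)
    exact h.comp_sub_const y x
  have hQc : ∀ (Q : ℂ[X]) (x : ℝ), Continuous (fun y : ℝ => Q.eval ((y - x : ℝ) : ℂ)) :=
    fun Q x => Q.continuous.comp (by fun_prop)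
  have hbd : ∀ Q : ℂ[X], ∃ C : ℝ, ∀ s ∈ Icc (0 : ℝ) 1, ‖Q.eval (s : ℂ)‖ ≤ C := fun Q =>
    isCompact_Icc.exists_bound_of_continuousOn
      (Q.continuous.comp Complex.continuous_ofReal).continuousOn
  obtain ⟨A, hA⟩ := hbd P
  obtain ⟨B, hB⟩ := hbd (derivative (derivative (derivative P)))
  have hlim := ((tendsto_integral_norm_window hc hF₃).const_mul A).add
    ((tendsto_integral_norm_window hcont₀ hF₀).const_mul B)
  simp only [mul_zero, add_zero] at hlim
  refine squeeze_zero_norm (fun x => ?_) hlim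
  -- The alternating signs make the derivative telescope to F₃P + F₀P‴. The bracket vanishes at x +
  -- 1, so its value at x is controlled by window integrals of ‖F₃‖ and ‖F₀‖.
  have hftc := intervalIntegral.integral_eq_sub_of_hasDerivAt (a := x) (b := x + 1)
    (f := fun y => F₂ y * P.eval ((y - x : ℝ) : ℂ) - F₁ y * (derivative P).eval ((y - x : ℝ) : ℂ)
      + F₀ y * (derivative (derivative P)).eval ((y - x : ℝ) : ℂ))
    (f' := fun y => F₃ y * P.eval ((y - x : ℝ) : ℂ)
      + F₀ y * (derivative (derivative (derivative P))).eval ((y - x : ℝ) : ℂ))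
    (fun y _ => by
      convert! (((h₂ y).mul (hQ P x y)).sub ((h₁ y).mul (hQ (derivative P) x y))).add
        ((h₀ y).mul (hQ (derivative (derivative P)) x y)) using 1
      ring)
    (((hc.mul (hQc _ x)).add (hcont₀.mul (hQc _ x))).intervalIntegrable _ _)
  simp only [add_sub_cancel_left, Complex.ofReal_one, hP, hP', hP'', mul_zero, sub_self, add_zero,
    zero_sub, Complex.ofReal_zero] at hftc
  rw [← norm_neg, ← hftc, ← intervalIntegral.integral_const_mul,
    ← intervalIntegral.integral_const_mul, ← intervalIntegral.integral_add]
  · refine intervalIntegral.norm_integral_le_of_norm_le (by linarith) (ae_of_all _ fun y hy => ?_)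
      ((by fun_prop : Continuous fun y => A * ‖F₃ y‖ + B * ‖F₀ y‖).intervalIntegrable _ _)
    have hy' : y - x ∈ Icc (0 : ℝ) 1 := ⟨by linarith [hy.1], by linarith [hy.2]⟩
    refine (norm_add_le _ _).trans ?_
    rw [norm_mul, norm_mul, mul_comm A, mul_comm B]
    gcongr
    · exact hA _ hy'
    · exact hB _ hy'
  · exact (hc.norm.const_mul A).intervalIntegrable _ _
  · exact (hcont₀.norm.const_mul B).intervalIntegrable _ _

-- No integrability of F₁ and F₂ is assumed: square integrability of the function and its third
-- derivative already controls the jet, once suitable polynomials isolate its entries.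
open Polynomial in
lemma tendsto_jet : Tendsto F₀ atTop (𝓝 0) ∧ Tendsto F₁ atTop (𝓝 0) ∧ Tendsto F₂ atTop (𝓝 0) := by
  -- The three polynomials are X²(1-X)³, X(1-X)³(1+3X) and (1-X)³(1+3X+6X²). Each has a triple root
  -- at 1, and their 2-jets at 0 single out 2F₀, -F₁ and F₂.
  have a := tendsto_jet_combination h₀ h₁ h₂ hc hF₀ hF₃ (X ^ 2 - 3 * X ^ 3 + 3 * X ^ 4 - X ^ 5)
    (by norm_num) (by norm_num) (by norm_num)
  have b := tendsto_jet_combination h₀ h₁ h₂ hc hF₀ hF₃ (X - 6 * X ^ 3 + 8 * X ^ 4 - 3 * X ^ 5)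
    (by norm_num) (by norm_num) (by norm_num)
  have c := tendsto_jet_combination h₀ h₁ h₂ hc hF₀ hF₃ (1 - 10 * X ^ 3 + 15 * X ^ 4 - 6 * X ^ 5)
    (by norm_num) (by norm_num) (by norm_num)
  norm_num at a b c
  exact ⟨by simpa using a.mul_const (2⁻¹ : ℂ), by simpa using b.neg, c⟩

/-- The energy flux of the Airy operator on the half line with Dirichlet condition. -/
lemma integral_re_conj_mul_nonneg (hzero : F₀ 0 = 0) :
    0 ≤ ∫ x in Ioi (0 : ℝ), 2 * (starRingEnd ℂ (F₀ x) * F₃ x).re := by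
  obtain ⟨t₀, t₁, t₂⟩ := tendsto_jet h₀ h₁ h₂ hc hF₀ hF₃
  have hint : IntegrableOn (fun x => 2 * (starRingEnd ℂ (F₀ x) * F₃ x).re) (Ioi 0) :=
    ((MemLp.integrable_mul hF₀.star hF₃).re).const_mul 2
  -- The integrand is the derivative of 2 Re(conj F₀ · F₂) - |F₁|². This vanishes at infinity and
  -- equals -|F₁(0)|² at the origin.
  have hd : ∀ x ∈ Ici (0 : ℝ), HasDerivAt
      (fun x => 2 * (starRingEnd ℂ (F₀ x) * F₂ x).re - (starRingEnd ℂ (F₁ x) * F₁ x).re)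
      (2 * (starRingEnd ℂ (F₀ x) * F₃ x).re) x := by
    intro x _
    have hre : ∀ {f : ℝ → ℂ} {f' : ℂ}, HasDerivAt f f' x →
        HasDerivAt (fun x => (f x).re) f'.re x := fun h =>
      (Complex.reCLM.hasFDerivAt.comp_hasDerivAt x h)
    have hstar : ∀ {f : ℝ → ℂ} {f' : ℂ}, HasDerivAt f f' x →
        HasDerivAt (fun x => starRingEnd ℂ (f x)) (starRingEnd ℂ f') x := fun h => h.star
    convert! ((hre ((hstar (h₀ x)).mul (h₂ x))).const_mul 2).sub
      (hre ((hstar (h₁ x)).mul (h₁ x))) using 1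
    simp
    ring
  have hlim : Tendsto
      (fun x => 2 * (starRingEnd ℂ (F₀ x) * F₂ x).re - (starRingEnd ℂ (F₁ x) * F₁ x).re)
      atTop (𝓝 0) := by
    have hstar : ∀ {f : ℝ → ℂ}, Tendsto f atTop (𝓝 0) →
        Tendsto (fun x => starRingEnd ℂ (f x)) atTop (𝓝 0) := fun h => by
      simpa using h.star
    have h1 := (Complex.continuous_re.tendsto _).comp ((hstar t₀).mul t₂)
    have h2 := (Complex.continuous_re.tendsto _).comp ((hstar t₁).mul t₁)
    simpa using (h1.const_mul 2).sub h2
  rw [integral_Ioi_of_hasDerivAt_of_tendsto' hd hint hlim, hzero]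
  simp only [map_zero, zero_mul, Complex.zero_re, mul_zero, zero_sub, neg_neg,
    Complex.mul_re, Complex.conj_re, Complex.conj_im]
  nlinarith [sq_nonneg (F₁ 0).re, sq_nonneg (F₁ 0).im]

end Decay

/-- If `u''' = -f` weakly on the half line and `u` vanishes at the origin, then the pairing of
`u` with `f` has nonpositive real part. -/
lemma integral_re_conj_mul_nonpos {u f : ℝ → ℂ} (hu : Continuous u) (hf : Continuous f)
    (hzero : u 0 = 0) (hu2 : MemLp u 2 (volume.restrict (Ioi 0)))
    (hf2 : MemLp f 2 (volume.restrict (Ioi 0)))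
    (h : ∀ φ, IsTest (Ioi 0) φ → ∫ x, iteratedDeriv 3 φ x • u x = ∫ x, φ x • f x) :
    ∫ x in Ioi (0 : ℝ), 2 * (starRingEnd ℂ (u x) * f x).re ≤ 0 := by
  have hI : IsOpen (Ioi (0 : ℝ)) := isOpen_Ioi
  have hne : (Ioi (0 : ℝ)).Nonempty := nonempty_Ioi
  have hcont : ∀ {F g : ℝ → ℂ}, (∀ x, HasDerivAt F (g x) x) → Continuous F := fun hd =>
    continuous_iff_continuousAt.2 fun x => (hd x).continuousAt
  -- Each application introduces a sign, so F₀' = -F₁, F₁' = -F₂, F₂' = f and u = -F₀.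
  obtain ⟨F₂, hF₂, e₂⟩ := exists_weak_primitive hI hne ordConnected_Ioi hu hf 2 h
  obtain ⟨F₁, hF₁, e₁⟩ := exists_weak_primitive hI hne ordConnected_Ioi hu (hcont hF₂).neg 1
    (fun φ hφ => by rw [e₂ φ hφ]; simp [integral_neg])
  obtain ⟨F₀, hF₀, e₀⟩ := exists_weak_primitive hI hne ordConnected_Ioi hu (hcont hF₁).neg 0
    (fun φ hφ => by rw [e₁ φ hφ]; simp [integral_neg])
  have hneg₁ : ∀ x, HasDerivAt (fun x => -F₁ x) (F₂ x) x := fun x => by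
    simpa using! (hF₁ x).neg
  -- Passing to the closure brings in the origin, where the boundary condition is needed.
  have heq : EqOn u (fun x => -F₀ x) (Ici 0) := by
    have := (eqOn_of_integral_smul_eq hI hu (hcont hF₀).neg
      (fun φ hφ => by have := e₀ φ hφ; simpa [integral_neg] using this)).closure hu
      (hcont hF₀).neg
    rwa [closure_Ioi] at this
  have hae : u =ᵐ[volume.restrict (Ioi 0)] fun x => -F₀ x :=
    (ae_restrict_iff' measurableSet_Ioi).2 (ae_of_all _ fun x hx => heq (Ioi_subset_Ici_self hx))
  have hF₀2 : MemLp F₀ 2 (volume.restrict (Ioi 0)) := by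
    simpa [Pi.neg_def] using ((memLp_congr_ae hae).1 hu2).neg
  have h00 : F₀ 0 = 0 := by
    have := heq (self_mem_Ici (a := (0 : ℝ)))
    simpa [hzero] using this.symm
  have key := integral_re_conj_mul_nonneg hF₀ hneg₁ hF₂ hf hF₀2 hf2 h00
  have : ∫ x in Ioi (0 : ℝ), 2 * (starRingEnd ℂ (u x) * f x).re
      = -∫ x in Ioi (0 : ℝ), 2 * (starRingEnd ℂ (F₀ x) * f x).re := by
    rw [← integral_neg]
    refine integral_congr_ae (hae.mono fun x hx => ?_)
    simp only [hx, map_neg, neg_mul, Complex.neg_re, mul_neg]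
  linarith

/-! ### From Sobolev slices to L² slices -/

lemma eLpNorm_le_sobolevNorm {s : ℝ} (hs : 0 ≤ s) (F : Lp ℂ 2 (volume : Measure ℝ)) :
    eLpNorm F 2 volume ≤ sobolevNorm s F := by
  have h1 : eLpNorm F 2 volume = eLpNorm (𝓕 F : Lp ℂ 2 (volume : Measure ℝ)) 2 volume := by
    rw [← Lp.enorm_def, ← Lp.enorm_def, ← ofReal_norm, ← ofReal_norm, Lp.norm_fourier_eq]
  rw [h1]
  refine eLpNorm_mono fun ξ => ?_
  rw [norm_mul, Complex.norm_real]
  refine le_mul_of_one_le_left (norm_nonneg _) ?_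
  exact (Real.one_le_rpow (by simp) hs).trans (le_abs_self _)

lemma eLpNorm_le_sobolevNormOn {s : ℝ} (hs : 0 ≤ s) (I : Set ℝ) (f : ℝ → ℂ) :
    eLpNorm f 2 (volume.restrict I) ≤ sobolevNormOn s I f := by
  refine le_iInf₂ fun F hF => ?_
  rw [← eLpNorm_congr_ae hF]
  exact (eLpNorm_restrict_le _ _ _ _).trans (eLpNorm_le_sobolevNorm hs F)

lemma MemSobolevOn.memLp {s : ℝ} (hs : 0 ≤ s) {I : Set ℝ} {f : ℝ → ℂ} (hf : MemSobolevOn s I f) :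
    MemLp f 2 (volume.restrict I) := by
  refine ⟨?_, (eLpNorm_le_sobolevNormOn hs I f).trans_lt hf⟩
  obtain ⟨F, hF⟩ := iInf_lt_iff.1 hf
  obtain ⟨hFf, -⟩ := iInf_lt_iff.1 hF
  exact (Lp.aestronglyMeasurable F).restrict.congr hFf

/-- All that the proof retains of the H^{1/3} regularity. -/
lemma ContinuousInSobolev.continuousInL2 {s : ℝ} (hs : 0 ≤ s) {J I : Set ℝ} {v : ℝ → ℝ → ℂ}
    (hv : ContinuousInSobolev s J I v) : ContinuousInL2 J I v :=
  ⟨fun x hx => (hv.1 x hx).memLp hs, fun x₀ hx₀ =>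
    tendsto_of_tendsto_of_tendsto_of_le_of_le tendsto_const_nhds (hv.2 x₀ hx₀)
      (fun _ => zero_le) fun _ => eLpNorm_le_sobolevNormOn hs I _⟩

namespace ContinuousInL2

variable {J I : Set ℝ} {v : ℝ → ℝ → ℂ}

lemma exists_bound (hv : ContinuousInL2 J I v) (hJ : IsCompact J) :
    ∃ C : ℝ≥0∞, C ≠ ⊤ ∧ ∀ t ∈ J, eLpNorm (v t) 2 (volume.restrict I) ≤ C := by
  refine hJ.induction_on (p := fun s => ∃ C : ℝ≥0∞, C ≠ ⊤ ∧ ∀ t ∈ s,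
    eLpNorm (v t) 2 (volume.restrict I) ≤ C) ⟨0, by simp, by simp⟩ ?_ ?_ ?_
  · rintro s t hst ⟨C, hC, h⟩
    exact ⟨C, hC, fun x hx => h x (hst hx)⟩
  · rintro s t ⟨C, hC, h⟩ ⟨D, hD, h'⟩
    refine ⟨max C D, by simp [hC, hD], ?_⟩
    rintro x (hx | hx)
    · exact (h x hx).trans (le_max_left _ _)
    · exact (h' x hx).trans (le_max_right _ _)
  · intro t₀ ht₀
    have hev := (hv.2 t₀ ht₀).eventually (gt_mem_nhds one_pos)
    refine ⟨{t | t ∈ J ∧ eLpNorm (v t - v t₀) 2 (volume.restrict I) < 1},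
      inter_mem self_mem_nhdsWithin hev, 1 + eLpNorm (v t₀) 2 (volume.restrict I),
      by simp [(hv.1 t₀ ht₀).eLpNorm_ne_top], ?_⟩
    rintro t ⟨htJ, ht⟩
    calc eLpNorm (v t) 2 (volume.restrict I)
        = eLpNorm ((v t - v t₀) + v t₀) 2 (volume.restrict I) := by simp
      _ ≤ eLpNorm (v t - v t₀) 2 (volume.restrict I) + eLpNorm (v t₀) 2 (volume.restrict I) :=
          eLpNorm_add_le ((hv.1 t htJ).sub (hv.1 t₀ ht₀)).1 (hv.1 t₀ ht₀).1 (by norm_num)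
      _ ≤ _ := by gcongr

lemma tendsto_lintegral_enorm_smul (hv : ContinuousInL2 J I v) {φ : ℝ → ℝ}
    (hφ : MemLp φ 2 (volume.restrict I)) {t₀ : ℝ} (ht₀ : t₀ ∈ J) :
    Tendsto (fun t => ∫⁻ x in I, ‖φ x • (v t x - v t₀ x)‖ₑ) (𝓝[J] t₀) (𝓝 0) := by
  have hlim : Tendsto (fun t => eLpNorm φ 2 (volume.restrict I)
      * eLpNorm (v t - v t₀) 2 (volume.restrict I)) (𝓝[J] t₀) (𝓝 0) := by
    simpa using ENNReal.Tendsto.const_mul (hv.2 t₀ ht₀) (Or.inr hφ.eLpNorm_ne_top)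
  refine tendsto_of_tendsto_of_tendsto_of_le_of_le' tendsto_const_nhds hlim
    (Eventually.of_forall fun _ => zero_le) ?_
  filter_upwards [self_mem_nhdsWithin] with t ht
  have := eLpNorm_smul_le_mul_eLpNorm (p := 2) (q := 2) (r := 1)
    ((hv.1 t ht).sub (hv.1 t₀ ht₀)).1 hφ.1
  rwa [eLpNorm_one_eq_lintegral_enorm] at this

lemma continuousOn_integral_smul (hv : ContinuousInL2 J I v) {φ : ℝ → ℝ}
    (hφ : MemLp φ 2 (volume.restrict I)) :
    ContinuousOn (fun t => ∫ x in I, φ x • v t x) J := by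
  intro t₀ ht₀
  rw [ContinuousWithinAt, tendsto_iff_edist_tendsto_0]
  refine tendsto_of_tendsto_of_tendsto_of_le_of_le' tendsto_const_nhds
    (hv.tendsto_lintegral_enorm_smul hφ ht₀) (Eventually.of_forall fun _ => zero_le) ?_
  filter_upwards [self_mem_nhdsWithin] with t ht
  have hi : ∀ t ∈ J, Integrable (fun x => φ x • v t x) (volume.restrict I) := fun t ht =>
    memLp_one_iff_integrable.1 ((hv.1 t ht).smul hφ)
  rw [edist_eq_enorm_sub, ← integral_sub (hi t ht) (hi t₀ ht₀)]
  simp_rw [← smul_sub]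
  exact enorm_integral_le_lintegral_enorm _

end ContinuousInL2

/-! ### Time primitives: continuity and bounds -/

/-- The primitive in the second variable of a continuous curve in `L¹` is jointly continuous. -/
lemma continuous_primitive {v : ℝ → ℝ → ℂ} (hint : ∀ x, Integrable (v x))
    (hv : ∀ x₀, Tendsto (fun x => ∫⁻ s, ‖v x s - v x₀ s‖ₑ) (𝓝 x₀) (𝓝 0)) :
    Continuous fun p : ℝ × ℝ => ∫ s in (0 : ℝ)..p.2, v p.1 s := by
  refine continuous_iff_continuousAt.2 fun ⟨x₀, t₀⟩ => ?_
  rw [ContinuousAt, tendsto_iff_edist_tendsto_0]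
  have h1 : Tendsto (fun p : ℝ × ℝ => ∫⁻ s, ‖v p.1 s - v x₀ s‖ₑ) (𝓝 (x₀, t₀)) (𝓝 0) :=
    (hv x₀).comp continuous_fst.continuousAt
  have h2 : Tendsto (fun p : ℝ × ℝ => edist (∫ s in (0 : ℝ)..p.2, v x₀ s)
      (∫ s in (0 : ℝ)..t₀, v x₀ s)) (𝓝 (x₀, t₀)) (𝓝 0) := by
    rw [← tendsto_iff_edist_tendsto_0]
    exact (((hint x₀).continuous_primitive 0).tendsto t₀).comp continuous_snd.continuousAt
  have h3 := h1.add h2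
  rw [add_zero] at h3
  refine tendsto_of_tendsto_of_tendsto_of_le_of_le tendsto_const_nhds h3 (fun _ => zero_le) ?_
  rintro ⟨x, t⟩
  refine (edist_triangle _ (∫ s in (0 : ℝ)..t, v x₀ s) _).trans (add_le_add_left ?_ _)
  rw [edist_eq_enorm_sub, ← intervalIntegral.integral_sub (hint x).intervalIntegrable
    (hint x₀).intervalIntegrable, intervalIntegral.intervalIntegral_eq_integral_uIoc]
  refine (enorm_smul_le).trans ?_
  have : ‖(if (0 : ℝ) ≤ t then (1 : ℝ) else -1)‖ₑ = 1 := by split_ifs <;> simp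
  rw [this, one_mul]
  exact (enorm_integral_le_lintegral_enorm _).trans (setLIntegral_le_lintegral _ _)

/-- The restriction of `w (max x 0)` to `(0, T)`, extended by zero. -/
def cutoff (T : ℝ) (w : ℝ → ℝ → ℂ) (x : ℝ) : ℝ → ℂ := (Ioo 0 T).indicator (w (max x 0))

/-- The primitive in time of `cutoff T w`. -/
def timePrimitive (T : ℝ) (w : ℝ → ℝ → ℂ) (x t : ℝ) : ℂ := ∫ s in (0 : ℝ)..t, cutoff T w x s

/-- The second primitive in time of `cutoff T w`. -/
def timePrimitive₂ (T : ℝ) (w : ℝ → ℝ → ℂ) (x t : ℝ) : ℂ :=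
  ∫ s in (0 : ℝ)..t, timePrimitive T w x s

/-- The `L¹(0, T)` norm of the slice at position `x`. -/
def sliceNorm (T : ℝ) (w : ℝ → ℝ → ℂ) (x : ℝ) : ℝ := ∫ s in Ioo 0 T, ‖w x s‖

/-- The pairing of the slice at time `t ∈ [0, T]` with `φ`, extended by constants. -/
def pairing (T : ℝ) (w : ℝ → ℝ → ℂ) (φ : ℝ → ℝ) (t : ℝ) : ℂ :=
  ∫ x in Ioi 0, φ x • w x (max 0 (min t T))

lemma IsTest.memLp {I : Set ℝ} {φ : ℝ → ℝ} (hφ : IsTest I φ) (μ : Measure ℝ)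
    [IsFiniteMeasureOnCompacts μ] : MemLp φ 2 μ :=
  hφ.contDiff.continuous.memLp_of_hasCompactSupport hφ.hasCompactSupport

lemma integral_Ioi_smul {φ : ℝ → ℝ} (hφ : IsTest (Ioi 0) φ) (u : ℝ → ℂ) :
    ∫ x in Ioi 0, φ x • u x = ∫ x, φ x • u x :=
  setIntegral_eq_integral_of_forall_compl_eq_zero fun x hx => by
    rw [hφ.eq_zero_of_notMem hx, zero_smul]

lemma restrict_domain (T : ℝ) : (volume : Measure (ℝ × ℝ)).restrict (domain T : Set (ℝ × ℝ))
    = (volume.restrict (Ioi (0 : ℝ))).prod (volume.restrict (Ioo 0 T)) := by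
  rw [Measure.prod_restrict]; rfl

lemma timePrimitive_eq_integral {T : ℝ} {w : ℝ → ℝ → ℂ} {x : ℝ} (hx : 0 < x) {t : ℝ}
    (ht : t ∈ Icc 0 T) :
    timePrimitive T w x t = ∫ s in Ioo 0 t, w x s := by
  rw [timePrimitive, intervalIntegral.integral_of_le ht.1, integral_Ioc_eq_integral_Ioo]
  refine setIntegral_congr_fun measurableSet_Ioo fun s hs => ?_
  have : s ∈ Ioo 0 T := ⟨hs.1, hs.2.trans_le ht.2⟩
  simp [cutoff, this, max_eq_left hx.le]

lemma pairing_of_mem {T : ℝ} {w : ℝ → ℝ → ℂ} {φ : ℝ → ℝ} {t : ℝ} (ht : t ∈ Icc 0 T) :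
    pairing T w φ t = ∫ x in Ioi 0, φ x • w x t := by
  rw [pairing, min_eq_left ht.2, max_eq_right ht.1]

section Solution

variable {T : ℝ} {w : ℝ → ℝ → ℂ} (hw : IsSolution T (fun _ => 0) (fun _ => 0) w)

include hw

lemma continuousInL2_space : ContinuousInL2 (Ici 0) (Ioo 0 T) w :=
  hw.continuous_space.continuousInL2 (by norm_num)

/-- Continuity on the compact time interval bounds the L² norms of the slices uniformly, and the
time interval has finite measure. -/
lemma memLp_prod : MemLp (fun p : ℝ × ℝ => w p.1 p.2) 2
    ((volume.restrict (Ioi (0 : ℝ))).prod (volume.restrict (Ioo 0 T))) := by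
  have hm := hw.aestronglyMeasurable
  rw [restrict_domain] at hm
  refine ⟨hm, ?_⟩
  obtain ⟨C, hC, hb⟩ := hw.continuous_time.exists_bound isCompact_Icc
  rw [eLpNorm_lt_top_iff_lintegral_rpow_enorm_lt_top (by norm_num) (by norm_num),
    lintegral_prod_symm _ (by fun_prop)]
  have hle : ∀ t ∈ Ioo 0 T, ∫⁻ x in Ioi 0, ‖w x t‖ₑ ^ (2 : ℝ≥0∞).toReal ≤ C ^ (2 : ℝ) := by
    intro t ht
    have := hb t (Ioo_subset_Icc_self ht)
    rw [eLpNorm_eq_lintegral_rpow_enorm_toReal (by norm_num) (by norm_num), one_div,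
      ENNReal.rpow_inv_le_iff (by norm_num)] at this
    simpa using this
  refine (setLIntegral_mono' measurableSet_Ioo hle).trans_lt ?_
  rw [setLIntegral_const]
  exact ENNReal.mul_lt_top (ENNReal.rpow_lt_top_of_nonneg (by norm_num) hC) (by simp)

lemma integrable_cutoff (x : ℝ) : Integrable (cutoff T w x) :=
  (integrable_indicator_iff measurableSet_Ioo).2
    (((continuousInL2_space hw).1 _ (le_max_right x 0)).integrable (by norm_num))

lemma continuous_timePrimitive :
    Continuous fun p : ℝ × ℝ => timePrimitive T w p.1 p.2 := by
  refine continuous_primitive (integrable_cutoff hw) fun x₀ => ?_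
  have h := (continuousInL2_space hw).tendsto_lintegral_enorm_smul (φ := fun _ => 1)
    (memLp_const 1) (le_max_right x₀ 0)
  -- Freezing the slices at x = 0 for negative x turns continuity on [0, ∞) into continuity on the
  -- whole line.
  have hmax : Tendsto (fun x : ℝ => max x 0) (𝓝 x₀) (𝓝[Ici 0] (max x₀ 0)) :=
    tendsto_nhdsWithin_iff.2 ⟨(continuous_id.max continuous_const).tendsto x₀,
      Eventually.of_forall fun x => le_max_right x 0⟩
  refine (h.comp hmax).congr fun x => ?_
  simp only [Function.comp, one_smul, cutoff]
  rw [← lintegral_indicator measurableSet_Ioo]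
  congr 1 with s
  by_cases hs : s ∈ Ioo 0 T <;> simp [hs]

lemma timePrimitive_zero_left (t : ℝ) : timePrimitive T w 0 t = 0 := by
  have h0 : ∀ᵐ s : ℝ, cutoff T w 0 s = 0 := by
    have := (ae_restrict_iff' measurableSet_Ioo).1 hw.lateral
    filter_upwards [this] with s hs
    by_cases h : s ∈ Ioo 0 T
    · simp [cutoff, h, hs h]
    · simp [cutoff, h]
  exact intervalIntegral.integral_zero_ae (h0.mono fun s hs _ => hs)

lemma timePrimitive₂_zero_left (t : ℝ) : timePrimitive₂ T w 0 t = 0 := by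
  simp [timePrimitive₂, timePrimitive_zero_left hw]

lemma continuous_timePrimitive₂ :
    Continuous fun p : ℝ × ℝ => timePrimitive₂ T w p.1 p.2 := by
  have hc : Continuous (Function.uncurry fun (p : ℝ × ℝ) s => timePrimitive T w p.1 s) :=
    (continuous_timePrimitive hw).comp
      (by fun_prop : Continuous fun q : (ℝ × ℝ) × ℝ => (q.1.1, q.2))
  exact intervalIntegral.continuous_parametric_intervalIntegral_of_continuous hc continuous_snd

lemma norm_timePrimitive_le {x : ℝ} (hx : 0 < x) {t : ℝ} (ht : 0 ≤ t) :
    ‖timePrimitive T w x t‖ ≤ sliceNorm T w x := by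
  have hi := (integrable_cutoff hw x).norm
  calc ‖timePrimitive T w x t‖ ≤ ∫ s in (0 : ℝ)..t, ‖cutoff T w x s‖ :=
        intervalIntegral.norm_integral_le_integral_norm ht
    _ = ∫ s in Ioc 0 t, ‖cutoff T w x s‖ := intervalIntegral.integral_of_le ht
    _ ≤ ∫ s, ‖cutoff T w x s‖ := setIntegral_le_integral hi (ae_of_all _ fun s => norm_nonneg _)
    _ = sliceNorm T w x := by
        rw [sliceNorm, ← integral_indicator measurableSet_Ioo]
        congr 1 with s
        by_cases hs : s ∈ Ioo 0 T <;> simp [cutoff, hs, max_eq_left hx.le]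

lemma norm_timePrimitive₂_le {x : ℝ} (hx : 0 < x) {t : ℝ} (ht : t ∈ Icc 0 T) :
    ‖timePrimitive₂ T w x t‖ ≤ T * sliceNorm T w x := by
  have h := intervalIntegral.norm_integral_le_of_norm_le_const (a := 0) (b := t)
    (f := timePrimitive T w x) (C := sliceNorm T w x) fun s hs => by
      rw [uIoc_of_le ht.1] at hs
      exact norm_timePrimitive_le hw hx hs.1.le
  refine h.trans ?_
  rw [sub_zero, abs_of_nonneg ht.1, mul_comm]
  exact mul_le_mul_of_nonneg_right ht.2 (integral_nonneg fun s => norm_nonneg _)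

/-- Up to a factor T, this norm bounds both primitives uniformly in time. It therefore gives their
L² membership in x and the domination in the Fubini arguments. -/
lemma memLp_sliceNorm : MemLp (sliceNorm T w) 2 (volume.restrict (Ioi 0)) := by
  have hm := memLp_prod hw
  have hmeas : AEStronglyMeasurable (sliceNorm T w) (volume.restrict (Ioi 0)) :=
    hm.1.norm.integral_prod_right'
  rw [memLp_two_iff_integrable_sq hmeas]
  have hsq := (hm.norm.integrable_sq).integral_prod_left.const_mul
    ((volume.restrict (Ioo 0 T)).real univ)
  refine hsq.mono' (hmeas.pow 2) ?_
  refine (ae_restrict_iff' measurableSet_Ioi).2 (ae_of_all _ fun x hx => ?_)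
  rw [Real.norm_of_nonneg (sq_nonneg _)]
  exact sq_integral_le ((continuousInL2_space hw).1 x (Ioi_subset_Ici_self hx)).norm

lemma memLp_timePrimitive {t : ℝ} (ht : 0 ≤ t) :
    MemLp (fun x => timePrimitive T w x t) 2 (volume.restrict (Ioi 0)) := by
  refine (memLp_sliceNorm hw).of_le
    (by have := continuous_timePrimitive hw; fun_prop)
    ((ae_restrict_iff' measurableSet_Ioi).2 (ae_of_all _ fun x hx => ?_))
  exact (norm_timePrimitive_le hw hx ht).trans (le_abs_self _)

lemma memLp_timePrimitive₂ {t : ℝ} (ht : t ∈ Icc 0 T) :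
    MemLp (fun x => timePrimitive₂ T w x t) 2 (volume.restrict (Ioi 0)) := by
  refine ((memLp_sliceNorm hw).const_mul T).of_le
    (by have := continuous_timePrimitive₂ hw; fun_prop)
    ((ae_restrict_iff' measurableSet_Ioi).2 (ae_of_all _ fun x hx => ?_))
  exact (norm_timePrimitive₂_le hw hx ht).trans (le_abs_self _)

lemma continuous_pairing (hT : 0 ≤ T) {φ : ℝ → ℝ} (hφ : IsTest (Ioi 0) φ) :
    Continuous (pairing T w φ) := by
  have h := hw.continuous_time.continuousOn_integral_smul (hφ.memLp _)
  refine h.comp_continuous (by fun_prop : Continuous fun t : ℝ => max 0 (min t T)) fun t => ?_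
  exact ⟨le_max_left _ _, max_le hT (min_le_right _ _)⟩

lemma integrable_smul_prod {φ : ℝ → ℝ} (hφ : IsTest (Ioi 0) φ) :
    Integrable (fun p : ℝ × ℝ => φ p.1 • w p.1 p.2)
      ((volume.restrict (Ioi (0 : ℝ))).prod (volume.restrict (Ioo 0 T))) :=
  memLp_one_iff_integrable.1 ((memLp_prod hw).smul ((hφ.memLp _).comp_fst _))

lemma integral_smul_timePrimitive {φ : ℝ → ℝ} (hφ : IsTest (Ioi 0) φ) {t : ℝ}
    (ht : t ∈ Icc 0 T) :
    ∫ x, φ x • timePrimitive T w x t = ∫ s in (0 : ℝ)..t, pairing T w φ s := by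
  have hsub : Ioo 0 t ⊆ Ioo 0 T := Ioo_subset_Ioo_right ht.2
  have hint : Integrable (fun p : ℝ × ℝ => φ p.1 • w p.1 p.2)
      ((volume.restrict (Ioi (0 : ℝ))).prod (volume.restrict (Ioo 0 t))) :=
    (integrable_smul_prod hw hφ).mono_measure
      (Measure.prod_mono le_rfl (Measure.restrict_mono hsub le_rfl))
  rw [← integral_Ioi_smul hφ]
  calc ∫ x in Ioi 0, φ x • timePrimitive T w x t
      = ∫ x in Ioi 0, ∫ s in Ioo 0 t, φ x • w x s := by
        refine setIntegral_congr_fun measurableSet_Ioi fun x hx => ?_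
        rw [timePrimitive_eq_integral hx ht, integral_smul]
    _ = ∫ s in Ioo 0 t, ∫ x in Ioi 0, φ x • w x s := integral_integral_swap hint
    _ = ∫ s in Ioo 0 t, pairing T w φ s :=
        setIntegral_congr_fun measurableSet_Ioo fun s hs =>
          (pairing_of_mem (Ioo_subset_Icc_self (hsub hs))).symm
    _ = ∫ s in (0 : ℝ)..t, pairing T w φ s := by
        rw [intervalIntegral.integral_of_le ht.1, integral_Ioc_eq_integral_Ioo]

end Solution

/-! ### The equation for the time primitives -/

/-- The tensor product of two test functions in one variable. -/
def tensorTest {T : ℝ} {φ η : ℝ → ℝ} (hφ : IsTest (Ioi 0) φ) (hη : IsTest (Ioo 0 T) η) :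
    𝓓(domain T, ℝ) where
  toFun p := φ p.1 * η p.2
  contDiff' := (hφ.contDiff.comp contDiff_fst).mul (hη.contDiff.comp contDiff_snd)
  hasCompactSupport' := by
    refine HasCompactSupport.of_support_subset_isCompact
      (hφ.hasCompactSupport.isCompact.prod hη.hasCompactSupport.isCompact) fun p hp => ?_
    have := mul_ne_zero_iff.1 hp
    exact ⟨subset_tsupport _ this.1, subset_tsupport _ this.2⟩
  tsupport_subset' := by
    have : tsupport (fun p : ℝ × ℝ => φ p.1 * η p.2) ⊆ tsupport φ ×ˢ tsupport η := by
      refine closure_minimal (fun p hp => ?_) ((isClosed_tsupport φ).prod (isClosed_tsupport η))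
      have := mul_ne_zero_iff.1 hp
      exact ⟨subset_tsupport _ this.1, subset_tsupport _ this.2⟩
    exact this.trans (prod_mono hφ.tsupport_subset hη.tsupport_subset)

section Solution

variable {T : ℝ} {w : ℝ → ℝ → ℂ} (hw : IsSolution T (fun _ => 0) (fun _ => 0) w)

include hw

lemma integrable_smul_smul_prod {φ η : ℝ → ℝ} (hφ : IsTest (Ioi 0) φ) (hη : IsTest (Ioo 0 T) η) :
    Integrable (fun p : ℝ × ℝ => η p.2 • φ p.1 • w p.1 p.2)
      ((volume.restrict (Ioi (0 : ℝ))).prod (volume.restrict (Ioo 0 T))) := by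
  obtain ⟨C, hC⟩ := hη.contDiff.continuous.bounded_above_of_compact_support hη.hasCompactSupport
  have hc := hη.contDiff.continuous
  exact (integrable_smul_prod hw hφ).bdd_smul C
    (by fun_prop : Continuous fun p : ℝ × ℝ => η p.2).aestronglyMeasurable
    (ae_of_all _ fun p => hC p.2)

lemma integral_prod_smul_smul {φ η : ℝ → ℝ} (hφ : IsTest (Ioi 0) φ) (hη : IsTest (Ioo 0 T) η) :
    ∫ p, η p.2 • φ p.1 • w p.1 p.2
      ∂((volume.restrict (Ioi (0 : ℝ))).prod (volume.restrict (Ioo 0 T)))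
      = ∫ t, η t • pairing T w φ t := by
  rw [integral_prod_symm _ (integrable_smul_smul_prod hw hφ hη),
    ← setIntegral_eq_integral_of_forall_compl_eq_zero (s := Ioo 0 T)
      (f := fun t => η t • pairing T w φ t)
      (fun t ht => by rw [hη.eq_zero_of_notMem ht, zero_smul])]
  refine setIntegral_congr_fun measurableSet_Ioo fun t ht => ?_
  simp only
  rw [integral_smul, pairing_of_mem (Ioo_subset_Icc_self ht)]

/-- The equation tested with φ(x)η(t): the pairing with φ has the pairing with φ‴ as its weak time
derivative. -/
lemma integral_deriv_smul_pairing {φ η : ℝ → ℝ} (hφ : IsTest (Ioi 0) φ)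
    (hη : IsTest (Ioo 0 T) η) :
    ∫ t, deriv η t • pairing T w φ t = ∫ t, η t • -pairing T w (iteratedDeriv 3 φ) t := by
  have h := hw.equation (tensorTest hφ hη)
  rw [restrict_domain] at h
  have hpt : ∀ p : ℝ × ℝ, w p.1 p.2 * ((deriv (fun t => tensorTest hφ hη (p.1, t)) p.2
        + iteratedDeriv 3 (fun x => tensorTest hφ hη (x, p.2)) p.1 : ℝ) : ℂ)
      = deriv η p.2 • φ p.1 • w p.1 p.2 + η p.2 • iteratedDeriv 3 φ p.1 • w p.1 p.2 := by
    intro p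
    have e1 : (fun t => tensorTest hφ hη (p.1, t)) = fun t => φ p.1 * η t := rfl
    have e2 : (fun x => tensorTest hφ hη (x, p.2)) = η p.2 • φ := by
      ext x; exact mul_comm _ _
    rw [e1, e2, deriv_const_mul_field, iteratedDeriv_const_smul_field]
    simp only [smul_eq_mul, Complex.real_smul]
    push_cast
    ring
  simp_rw [hpt] at h
  rw [integral_add (integrable_smul_smul_prod hw hφ hη.deriv)
    (integrable_smul_smul_prod hw (hφ.iteratedDeriv 3) hη),
    integral_prod_smul_smul hw hφ hη.deriv, integral_prod_smul_smul hw (hφ.iteratedDeriv 3) hη] at h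
  simp only [smul_neg, integral_neg]
  exact eq_neg_of_add_eq_zero_left h

lemma pairing_zero (hT : 0 < T) (φ : ℝ → ℝ) : pairing T w φ 0 = 0 := by
  rw [pairing_of_mem (left_mem_Icc.2 hT.le)]
  exact integral_eq_zero_of_ae (hw.initial.mono fun x hx => by simp [hx])

/-- The pairing is continuous up to t = 0, where it vanishes by the initial condition, so its weak
derivative integrates with no constant. -/
lemma pairing_eq_integral (hT : 0 < T) {φ : ℝ → ℝ} (hφ : IsTest (Ioi 0) φ) {t : ℝ}
    (ht : t ∈ Icc 0 T) :
    pairing T w φ t = ∫ s in (0 : ℝ)..t, pairing T w (iteratedDeriv 3 φ) s := by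
  have hc := continuous_pairing hw hT.le hφ
  have hc3 := continuous_pairing hw hT.le (hφ.iteratedDeriv 3)
  obtain ⟨F, hF, e⟩ := exists_weak_primitive isOpen_Ioo (nonempty_Ioo.2 hT) ordConnected_Ioo hc
    hc3.neg 0 fun η hη => by
      rw [zero_add, iteratedDeriv_one]; exact integral_deriv_smul_pairing hw hφ hη
  have hFc : Continuous F := continuous_iff_continuousAt.2 fun x => (hF x).continuousAt
  have heq : EqOn (pairing T w φ) (fun t => -F t) (Icc 0 T) := by
    have := (eqOn_of_integral_smul_eq isOpen_Ioo hc hFc.neg (fun η hη => by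
      have := e η hη
      simpa [integral_neg] using this)).closure hc hFc.neg
    rwa [closure_Ioo hT.ne] at this
  have hftc := intervalIntegral.integral_eq_sub_of_hasDerivAt (a := 0) (b := t)
    (fun s _ => hF s) (hc3.neg.intervalIntegrable _ _)
  simp only [Pi.neg_apply, intervalIntegral.integral_neg] at hftc
  have h0 := heq (left_mem_Icc.2 hT.le)
  have h1 := heq ht
  rw [pairing_zero hw hT] at h0
  rw [h1]
  simp only at h0
  linear_combination hftc - h0

/-- The weak form of `∂ₓ³ timePrimitive₂ = -timePrimitive`. -/
lemma integral_iteratedDeriv_smul_timePrimitive₂ (hT : 0 < T) {φ : ℝ → ℝ}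
    (hφ : IsTest (Ioi 0) φ) {t : ℝ} (ht : t ∈ Icc 0 T) :
    ∫ x, iteratedDeriv 3 φ x • timePrimitive₂ T w x t = ∫ x, φ x • timePrimitive T w x t := by
  have hφ3 := hφ.iteratedDeriv 3
  have hint : Integrable (Function.uncurry fun x s => iteratedDeriv 3 φ x • timePrimitive T w x s)
      ((volume.restrict (Ioi (0 : ℝ))).prod (volume.restrict (Ioc 0 t))) := by
    have hdom : Integrable (fun x => iteratedDeriv 3 φ x * sliceNorm T w x)
        (volume.restrict (Ioi 0)) := (hφ3.memLp _).integrable_mul (memLp_sliceNorm hw)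
    refine (hdom.comp_fst (volume.restrict (Ioc 0 t))).mono ?_ ?_
    · have h1 := continuous_timePrimitive hw
      have h2 := hφ3.contDiff.continuous
      exact (by simp only [Function.uncurry_def]; fun_prop : Continuous _).aestronglyMeasurable
    · rw [Measure.prod_restrict]
      refine (ae_restrict_iff' (measurableSet_Ioi.prod measurableSet_Ioc)).2
        (ae_of_all _ fun p hp => ?_)
      simp only [Function.uncurry_def, norm_smul, norm_mul]
      gcongr
      exact (norm_timePrimitive_le hw hp.1 hp.2.1.le).trans (le_abs_self _)
  rw [integral_smul_timePrimitive hw hφ ht, ← integral_Ioi_smul hφ3]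
  calc ∫ x in Ioi 0, iteratedDeriv 3 φ x • timePrimitive₂ T w x t
      = ∫ x in Ioi 0, ∫ s in Ioc 0 t, iteratedDeriv 3 φ x • timePrimitive T w x s := by
        simp_rw [timePrimitive₂, intervalIntegral.integral_of_le ht.1, integral_smul]
    _ = ∫ s in Ioc 0 t, ∫ x in Ioi 0, iteratedDeriv 3 φ x • timePrimitive T w x s :=
        integral_integral_swap hint
    _ = ∫ s in Ioc 0 t, pairing T w φ s := by
        refine setIntegral_congr_fun measurableSet_Ioc fun s hs => ?_
        have hs' : s ∈ Icc 0 T := ⟨hs.1.le, hs.2.trans ht.2⟩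
        rw [integral_Ioi_smul hφ3, integral_smul_timePrimitive hw hφ3 hs',
          pairing_eq_integral hw hT hφ hs']
    _ = ∫ s in (0 : ℝ)..t, pairing T w φ s := (intervalIntegral.integral_of_le ht.1).symm

/-! ### The energy estimate -/

lemma hasDerivAt_timePrimitive₂ (x t : ℝ) :
    HasDerivAt (timePrimitive₂ T w x) (timePrimitive T w x t) t := by
  have hc : Continuous (timePrimitive T w x) := by
    have := continuous_timePrimitive hw
    exact this.comp (by fun_prop : Continuous fun t : ℝ => (x, t))
  exact intervalIntegral.integral_hasDerivAt_right (hc.intervalIntegrable _ _)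
    (hc.stronglyMeasurableAtFilter _ _) hc.continuousAt

lemma norm_sq_timePrimitive₂ (x t : ℝ) : ‖timePrimitive₂ T w x t‖ ^ 2
    = ∫ s in (0 : ℝ)..t, 2 * (starRingEnd ℂ (timePrimitive₂ T w x s) * timePrimitive T w x s).re := by
  have hd : ∀ s, HasDerivAt (fun s => ‖timePrimitive₂ T w x s‖ ^ 2)
      (2 * (starRingEnd ℂ (timePrimitive₂ T w x s) * timePrimitive T w x s).re) s := by
    intro s
    have h := (hasDerivAt_timePrimitive₂ hw x s).norm_sq
    convert! h using 2
    rw [Complex.inner, mul_comm]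
  have hc : Continuous fun s =>
      2 * (starRingEnd ℂ (timePrimitive₂ T w x s) * timePrimitive T w x s).re := by
    have h1 := continuous_timePrimitive hw
    have h2 := continuous_timePrimitive₂ hw
    fun_prop
  rw [intervalIntegral.integral_eq_sub_of_hasDerivAt (fun s _ => hd s)
    (hc.intervalIntegrable _ _)]
  simp [timePrimitive₂]

lemma timePrimitive₂_eq_zero (hT : 0 < T) {x : ℝ} (hx : 0 < x) {t : ℝ} (ht : t ∈ Icc 0 T) :
    timePrimitive₂ T w x t = 0 := by
  have hc₁ := continuous_timePrimitive hw
  have hc₂ := continuous_timePrimitive₂ hw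
  have hint : Integrable (Function.uncurry fun x s =>
      2 * (starRingEnd ℂ (timePrimitive₂ T w x s) * timePrimitive T w x s).re)
      ((volume.restrict (Ioi (0 : ℝ))).prod (volume.restrict (Ioc 0 t))) := by
    have hdom := ((memLp_sliceNorm hw).integrable_sq.const_mul (2 * T)).comp_fst
      (volume.restrict (Ioc 0 t))
    refine hdom.mono' ?_ ?_
    · exact (by simp only [Function.uncurry_def]; fun_prop : Continuous _).aestronglyMeasurable
    · rw [Measure.prod_restrict]
      refine (ae_restrict_iff' (measurableSet_Ioi.prod measurableSet_Ioc)).2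
        (ae_of_all _ fun p hp => ?_)
      have h1 := norm_timePrimitive_le hw hp.1 hp.2.1.le
      have h2 := norm_timePrimitive₂_le hw hp.1 ⟨hp.2.1.le, hp.2.2.trans ht.2⟩
      have h3 := Complex.abs_re_le_norm
        (starRingEnd ℂ (timePrimitive₂ T w p.1 p.2) * timePrimitive T w p.1 p.2)
      rw [norm_mul, Complex.norm_conj] at h3
      have h4 := mul_le_mul h2 h1 (norm_nonneg _) ((norm_nonneg _).trans h2)
      simp only [Function.uncurry_def, norm_mul, Real.norm_eq_abs]
      rw [abs_of_pos (two_pos : (0 : ℝ) < 2)]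
      nlinarith
  -- The energy at time t is the time integral of its production rate, and that rate is nonpositive
  -- at each time by the flux inequality.
  have hE : ∫ x in Ioi (0 : ℝ), ‖timePrimitive₂ T w x t‖ ^ 2 ≤ 0 := by
    simp_rw [norm_sq_timePrimitive₂ hw, intervalIntegral.integral_of_le ht.1]
    rw [integral_integral_swap hint]
    refine setIntegral_nonpos measurableSet_Ioc fun s hs => ?_
    have hs' : s ∈ Icc 0 T := ⟨hs.1.le, hs.2.trans ht.2⟩
    exact integral_re_conj_mul_nonpos (by fun_prop) (by fun_prop) (timePrimitive₂_zero_left hw s)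
      (memLp_timePrimitive₂ hw hs') (memLp_timePrimitive hw hs'.1)
      fun φ hφ => integral_iteratedDeriv_smul_timePrimitive₂ hw hT hφ hs'
  have hsq : Integrable (fun x => ‖timePrimitive₂ T w x t‖ ^ 2) (volume.restrict (Ioi 0)) :=
    (memLp_timePrimitive₂ hw ht).norm.integrable_sq
  have hz := (integral_eq_zero_iff_of_nonneg (fun x => sq_nonneg _) hsq).1
    (hE.antisymm (integral_nonneg fun x => sq_nonneg _))
  have := Measure.eqOn_open_of_ae_eq hz isOpen_Ioi
    (by fun_prop : Continuous fun x => ‖timePrimitive₂ T w x t‖ ^ 2).continuousOn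
    continuousOn_const hx
  simpa using this

lemma timePrimitive_eq_zero (hT : 0 < T) {x : ℝ} (hx : 0 < x) {t : ℝ} (ht : t ∈ Ioo 0 T) :
    timePrimitive T w x t = 0 := by
  have h : timePrimitive₂ T w x =ᶠ[𝓝 t] fun _ => 0 := by
    filter_upwards [Ioo_mem_nhds ht.1 ht.2] with s hs
    exact timePrimitive₂_eq_zero hw hT hx (Ioo_subset_Icc_self hs)
  exact (hasDerivAt_timePrimitive₂ hw x t).unique
    ((hasDerivAt_const t (0 : ℂ)).congr_of_eventuallyEq h)

/-! ### Back to the slices of the solution -/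

lemma ae_slice_eq_zero (hT : 0 < T) {x : ℝ} (hx : 0 < x) :
    ∀ᵐ t ∂(volume.restrict (Ioo 0 T)), w x t = 0 := by
  rw [ae_restrict_iff' measurableSet_Ioo]
  -- Lebesgue differentiation: the slice is almost everywhere the derivative of its vanishing
  -- primitive.
  filter_upwards [LocallyIntegrable.ae_hasDerivAt_integral
    (integrable_cutoff hw x).locallyIntegrable] with t h ht
  have hev : timePrimitive T w x =ᶠ[𝓝 t] fun _ => 0 := by
    filter_upwards [Ioo_mem_nhds ht.1 ht.2] with s hs
    exact timePrimitive_eq_zero hw hT hx hs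
  have := (h 0).unique ((hasDerivAt_const t (0 : ℂ)).congr_of_eventuallyEq hev)
  simpa [cutoff, ht.1, ht.2, max_eq_left hx.le] using this

lemma ae_ae_slice_eq_zero (hT : 0 < T) :
    ∀ᵐ t ∂(volume.restrict (Ioo 0 T)), ∀ᵐ x ∂(volume.restrict (Ioi 0)), w x t = 0 := by
  have hm := (memLp_prod hw).1
  have h0 : ∫⁻ p, ‖w p.1 p.2‖ₑ
      ∂((volume.restrict (Ioi (0 : ℝ))).prod (volume.restrict (Ioo 0 T))) = 0 := by
    rw [lintegral_prod _ hm.enorm]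
    refine (setLIntegral_congr_fun measurableSet_Ioi fun x hx => ?_).trans lintegral_zero
    exact (lintegral_congr_ae ((ae_slice_eq_zero hw hT hx).mono fun t ht => by simp [ht])).trans
      lintegral_zero
  have h1 := (lintegral_eq_zero_iff' hm.prod_swap.enorm).1
    ((lintegral_prod_swap (μ := volume.restrict (Ioi (0 : ℝ))) (ν := volume.restrict (Ioo 0 T))
      (fun p : ℝ × ℝ => ‖w p.1 p.2‖ₑ)).trans h0)
  filter_upwards [Measure.ae_ae_of_ae_prod h1] with t ht
  exact ht.mono fun x hx => by simpa using hx

/-- Slices vanish at almost every time; continuity in L²(0, ∞) extends this to every time, endpoints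
included. -/
lemma time_slice_eq_zero (hT : 0 < T) {t : ℝ} (ht : t ∈ Icc 0 T) :
    ∀ᵐ x ∂(volume.restrict (Ioi 0)), w x t = 0 := by
  have hmem := hw.continuous_time.1 t ht
  suffices h : eLpNorm (fun x => w x t) 2 (volume.restrict (Ioi 0)) = 0 from
    (eLpNorm_eq_zero_iff hmem.1 (by norm_num)).1 h
  by_contra hne
  have hev := (hw.continuous_time.2 t ht).eventually (gt_mem_nhds (pos_iff_ne_zero.2 hne))
  obtain ⟨U, hU, htU, hsub⟩ := mem_nhdsWithin.1 hev
  have hcl : t ∈ closure (Ioo 0 T) := by rwa [closure_Ioo hT.ne]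
  have hpos : 0 < volume (U ∩ Ioo 0 T) :=
    (hU.inter isOpen_Ioo).measure_pos volume (mem_closure_iff.1 hcl U hU htU)
  have hae := (ae_restrict_iff' measurableSet_Ioo).1 (ae_ae_slice_eq_zero hw hT)
  -- A time s near t with zero slice: the distance between the two slices is then the norm at t, yet
  -- also strictly smaller.
  obtain ⟨s, ⟨hsU, hsI⟩, hs⟩ := (frequently_ae_mem_iff.2 hpos.ne').and_eventually hae |>.exists
  have hlt := hsub ⟨hsU, Ioo_subset_Icc_self hsI⟩
  refine (lt_irrefl _ : ¬ eLpNorm (fun x => w x t) 2 (volume.restrict (Ioi 0)) < _)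
    (lt_of_eq_of_lt ?_ hlt)
  rw [← eLpNorm_neg]
  refine eLpNorm_congr_ae ((hs hsI).mono fun x hx => ?_)
  simp [hx]

end Solution

end AiryQuarterPlane

end

theorem theorem6p3 (T₀ : ℝ) (hT₀ : 0 < T₀) (w : ℝ → ℝ → ℂ)
    (hw : AiryQuarterPlane.IsSolution T₀ (fun _ => 0) (fun _ => 0) w) :
    (∀ t ∈ Set.Icc (0 : ℝ) T₀, ∀ᵐ x ∂(volume.restrict (Set.Ioi (0 : ℝ))), w x t = 0) ∧
    (∀ x ∈ Set.Ici (0 : ℝ), ∀ᵐ t ∂(volume.restrict (Set.Ioo (0 : ℝ) T₀)), w x t = 0) := by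
  refine ⟨fun t ht => AiryQuarterPlane.time_slice_eq_zero hw hT₀ ht, fun x hx => ?_⟩
  rcases (Set.mem_Ici.1 hx).eq_or_lt with rfl | hpos
  · exact hw.lateral
  · exact AiryQuarterPlane.ae_slice_eq_zero hw hT₀ hpos
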